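/- The two-dimensional Lieb lattice is the graph whose vertices are the points of $\mathbb Z^2$ whose coordinates are not both odd, two vertices being joined when their $\ell^1$-distance is $1$. Let $A$ be its adjacency operator, written as an operator on $\ell^2(\mathbb Z^2,\mathbb C^3)$ by letting $\psi_1(n),\psi_2(n),\psi_3(n)$ be the values at the vertices $2n$, $2n+(1,0)$, $2n+(0,1)$. Its symbol is $$p(z)=\begin{pmatrix}0&1+z_1^{-1}&1+z_2^{-1}\\ 1+z_1&0&0\\ 1+z_2&0&0\end{pmatrix},\qquad z\in(\mathbb C\setminus\{0\})^2 .$$ Let $q=(q_1,q_2)$ be positive integers, and let $V=(V_1,V_2,V_3):\mathbb Z^2\to\mathbb C^3$ be $q$-periodic, i.e. $V(n_1+l_1q_1,n_2+l_2q_2)=V(n_1,n_2)$ for all $n,l\in\mathbb Z^2$. Put $W=\{w\in\mathbb Z^2:0\le w_i<q_i\}$ and $Q=q_1q_2$. On $\mathbb C^{\{1,2,3\}\times W}$ let $D_z$ be the block-diagonal matrix with diagonal blocks $p(e^{2\pi i w_1/q_1}z_1,\,e^{2\pi i w_2/q_2}z_2)$, $w\in W$, and let $B_V$ be the matrix whose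 $(w,w')$ block is $\operatorname{diag}(\widehat V_1(w-w'),\widehat V_2(w-w'),\widehat V_3(w-w'))$, where $\widehat V_j(m)=\frac1Q\sum_{n\in W}e^{-2\pi i(m_1n_1/q_1+m_2n_2/q_2)}V_j(n)$. For $\lambda\in\mathbb C$ the Fermi variety of $A+V$ at energy $\lambda$ is the set $$F_\lambda=\{(z_1^{q_1},z_2^{q_2}) : z\in(\mathbb C\setminus\{0\})^2,\ \det(D_z+B_V-\lambda I)=0\}$$ of Floquet multipliers. Suppose $\gcd(q_1,q_2)=1$. Then for all but finitely many $\lambda\in\mathbb C$ the following holds: there is a Laurent polynomial $\mathcal P\in\mathbb C[x_1^{\pm1},x_2^{\pm1}]$ such that $\det(D_z+B_V-\lambda I)=\mathcal P(z_1^{q_1},z_2^{q_2})$ for all $z\in(\mathbb C\setminus\{0\})^2$ and such that $\mathcal P$ is irreducible in $\mathbb C[x_1^{\pm1},x_2^{\pm1}]$; and $F_\lambda$ is an irreducible subvariety of $(\mathbb C\setminus\{0\})^2$ (nonempty, Zariski closed, and not the union of two proper Zariski closed subsets). -/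

import Mathlib

noncomputable section

namespace PeriodicGraph

/-! ### Laurent polynomials and varieties in the complex torus -/

/-- The ring of Laurent polynomials `ℂ[x₁^{±1}, …, x_d^{±1}]`; exponents are vectors in `ℤ^d`. -/
abbrev Laurent (d : ℕ) : Type := AddMonoidAlgebra ℂ (Fin d → ℤ)

/-- The algebraic torus `(ℂ^⋆)^d`. -/
abbrev Torus (d : ℕ) : Type := Fin d → ℂˣ

/-- The monomial `x^α = x₁^{α₁} ⋯ x_d^{α_d}` as a function on the torus. -/
def monomialValue {d : ℕ} (x : Torus d) (α : Fin d → ℤ) : ℂ :=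
  ∏ i, ((x i ^ α i : ℂˣ) : ℂ)

/-- The value `∑ c_α x^α` of a Laurent polynomial at a point of the torus. -/
def Laurent.value {d : ℕ} (f : Laurent d) (x : Torus d) : ℂ :=
  Finsupp.sum f.coeff fun α c => c * monomialValue x α

/-- Zariski closed subsets of the torus: common zero sets of Laurent polynomials. -/
def IsZariskiClosed {d : ℕ} (Z : Set (Torus d)) : Prop :=
  ∃ S : Set (Laurent d), Z = {x | ∀ f ∈ S, f.value x = 0}

/-- An irreducible subvariety of the torus: nonempty, Zariski closed, and not the union of two
proper Zariski closed subsets. -/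
def IsIrreducibleVariety {d : ℕ} (X : Set (Torus d)) : Prop :=
  X.Nonempty ∧ IsZariskiClosed X ∧
    ∀ Z₁ Z₂ : Set (Torus d), IsZariskiClosed Z₁ → IsZariskiClosed Z₂ →
      X ⊆ Z₁ ∪ Z₂ → X ⊆ Z₁ ∨ X ⊆ Z₂

/-! ### Floquet matrices of periodic matrix-valued Schrödinger operators -/

/-- `V : ℤ^d → ℂ^ν` is `q`-periodic: `V (n + l ⊙ q) = V n` for all `n, l ∈ ℤ^d`. -/
def IsPeriodic {d ν : ℕ} (q : Fin d → ℕ) (V : (Fin d → ℤ) → Fin ν → ℂ) : Prop :=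
  ∀ n l : Fin d → ℤ, V (fun i => n i + l i * (q i : ℤ)) = V n

/-- The fundamental domain `W = {w ∈ ℤ^d : 0 ≤ w_i < q_i}` of the period lattice. -/
abbrev Cell {d : ℕ} (q : Fin d → ℕ) : Type := (i : Fin d) → Fin (q i)

/-- A point of the fundamental domain as a vector in `ℤ^d`. -/
def Cell.toInt {d : ℕ} {q : Fin d → ℕ} (w : Cell q) : Fin d → ℤ :=
  fun i => ((w i : ℕ) : ℤ)

/-- The componentwise product `μ_n ⊙ z`, where `μ_n = (e^{2πi n₁/q₁}, …, e^{2πi n_d/q_d})`. -/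
def twist {d : ℕ} (q : Fin d → ℕ) (n : Fin d → ℤ) (z : Torus d) : Torus d :=
  fun i => Units.mk0 (Complex.exp (2 * Real.pi * Complex.I * ((n i : ℂ) / (q i : ℂ))))
    (Complex.exp_ne_zero _) * z i

/-- The symbol `p(z) = ∑_n A(n) z^{-n}` of the Toeplitz operator
`(Aψ)(l) = ∑_{l'} A(l - l') ψ(l')` whose matrix coefficients `A(n)_{ij} = a i j n` vanish for all
but finitely many `n`. -/
def symbol {d ν : ℕ} (a : Fin ν → Fin ν → (Fin d → ℤ) → ℂ) (z : Torus d) :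
    Matrix (Fin ν) (Fin ν) ℂ :=
  Matrix.of fun i j => ∑ᶠ n : Fin d → ℤ, a i j n * monomialValue z (-n)

/-- The block diagonal matrix `D_z` with diagonal blocks `p(μ_w ⊙ z)`, `w ∈ W`. -/
def blockD {d ν : ℕ} (q : Fin d → ℕ) (a : Fin ν → Fin ν → (Fin d → ℤ) → ℂ) (z : Torus d) :
    Matrix (Cell q × Fin ν) (Cell q × Fin ν) ℂ :=
  Matrix.of fun r s => if r.1 = s.1 then symbol a (twist q r.1.toInt z) r.2 s.2 else 0

/-- The Fourier coefficient
`(1/Q) ∑_{n ∈ W} e^{-2πi (m₁n₁/q₁ + ⋯ + m_dn_d/q_d)} g(n)`, `Q = q₁ ⋯ q_d`,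
of a `q`-periodic function `g`. -/
def fourierCoeff {d : ℕ} (q : Fin d → ℕ) (g : (Fin d → ℤ) → ℂ) (m : Fin d → ℤ) : ℂ :=
  (∏ i, (q i : ℂ))⁻¹ * ∑ n : Cell q,
    Complex.exp (-(2 * Real.pi * Complex.I * ∑ i, (m i : ℂ) * (n.toInt i : ℂ) / (q i : ℂ)))
      * g n.toInt

/-- The matrix `B_V`, whose `(w, w')` block is diagonal with entries `V̂_j(w - w')`: this is
multiplication by `V` in the basis of Floquet plane waves. -/
def blockB {d ν : ℕ} (q : Fin d → ℕ) (V : (Fin d → ℤ) → Fin ν → ℂ) :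
    Matrix (Cell q × Fin ν) (Cell q × Fin ν) ℂ :=
  Matrix.of fun r s =>
    if r.2 = s.2 then fourierCoeff q (fun n => V n r.2) (r.1.toInt - s.1.toInt) else 0

/-- `det(D_z + B_V - λ I)`. -/
def floquetDet {d ν : ℕ} (q : Fin d → ℕ) (a : Fin ν → Fin ν → (Fin d → ℤ) → ℂ)
    (V : (Fin d → ℤ) → Fin ν → ℂ) (lam : ℂ) (z : Torus d) : ℂ :=
  (blockD q a z + blockB q V - lam • (1 : Matrix (Cell q × Fin ν) (Cell q × Fin ν) ℂ)).det

/-- The vector of Floquet multipliers `z^{⊙ q} = (z₁^{q₁}, …, z_d^{q_d})`. -/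
def multipliers {d : ℕ} (q : Fin d → ℕ) (z : Torus d) : Torus d := fun i => z i ^ q i

/-- `P` is the Laurent polynomial with `det(D_z + B_V - λ I) = P(z^{⊙ q})` (there is at most one
when all `q_i` are positive). -/
def IsFermiPolynomial {d ν : ℕ} (q : Fin d → ℕ) (a : Fin ν → Fin ν → (Fin d → ℤ) → ℂ)
    (V : (Fin d → ℤ) → Fin ν → ℂ) (lam : ℂ) (P : Laurent d) : Prop :=
  ∀ z : Torus d, floquetDet q a V lam z = P.value (multipliers q z)

/-- The Fermi variety of `A + V` at energy `λ`: the set of Floquet multipliers `z^{⊙ q}` with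
`det(D_z + B_V - λ I) = 0`. With `z = exp(2πi k)` this is the set of complex quasimomenta `k` with
`det(D_z + B_V - λ I) = 0`, modulo the dual lattice `(1/q₁)ℤ ⊕ ⋯ ⊕ (1/q_d)ℤ`. -/
def fermiVariety {d ν : ℕ} (q : Fin d → ℕ) (a : Fin ν → Fin ν → (Fin d → ℤ) → ℂ)
    (V : (Fin d → ℤ) → Fin ν → ℂ) (lam : ℂ) : Set (Torus d) :=
  multipliers q '' {z | floquetDet q a V lam z = 0}

/-! ### The Lieb lattice -/

/-- Vertices of the Lieb lattice: points of `ℤ²` whose coordinates are not both odd. -/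
abbrev LiebVertex : Type := {n : Fin 2 → ℤ // ¬ (Odd (n 0) ∧ Odd (n 1))}

/-- The Lieb lattice: two vertices are joined when their `ℓ¹` distance is one. -/
def liebGraph : SimpleGraph LiebVertex where
  Adj m n := |m.1 0 - n.1 0| + |m.1 1 - n.1 1| = 1
  symm := ⟨fun m n h => by rwa [abs_sub_comm (n.1 0), abs_sub_comm (n.1 1)]⟩
  loopless := ⟨fun m h => by simp at h⟩

/-- The representatives `(0,0)`, `(1,0)`, `(0,1)` of the three vertex orbits under translation by
`2ℤ ⊕ 2ℤ`. -/
def liebBase : Fin 3 → Fin 2 → ℤ := ![![0, 0], ![1, 0], ![0, 1]]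

/-- The vertex of type `j` in the cell `n ∈ ℤ²`, at the position `v_j + 2n`. -/
def liebVertex (j : Fin 3) (n : Fin 2 → ℤ) : LiebVertex :=
  ⟨fun i => liebBase j i + 2 * n i, by
    fin_cases j <;> simp [liebBase, Int.odd_iff]⟩

open Classical in
/-- The matrix coefficients `a^{ij}_n = ⟨δ_{v_i + 2n}, A δ_{v_j}⟩` of the adjacency operator `A` of
the Lieb lattice. -/
def liebCoeff (i j : Fin 3) (n : Fin 2 → ℤ) : ℂ :=
  if liebGraph.Adj (liebVertex i n) (liebVertex j 0) then 1 else 0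

end PeriodicGraph

end

noncomputable section

namespace PeriodicGraph

open AddMonoidAlgebra

/-! ### Laurent polynomials as functions on the torus. -/

section Value

variable {d : ℕ}

/-! The argument reads irreducibility off the Newton polygon. Vertices of types 1 and 2 are adjacent
only to type 0. When `lam` avoids the eigenvalues of their two potential blocks, a Schur complement
removes them and leaves, up to a nonzero constant, `det (T₀ + z₁ T₁ + z₁⁻¹ S₁ + z₂ T₂ + z₂⁻¹ S₂)`
with `T₁, S₁, T₂, S₂` invertible of size `Q = q 0 * q 1` (`exists_det_liebMatrix_eq`). Its Newton
polygon is therefore the full diamond with vertices `(±Q, 0)`, `(0, ±Q)`.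

Dual-lattice invariance (`floquetDet_twist`) makes the determinant a Laurent polynomial `P` in the
multipliers. The vertices of `P` are `(±q 1, 0)`, `(0, ±q 0)`, and coprimality makes the edges
primitive. In a factorization each edge then belongs to a single factor. Either one factor is a
monomial, or both are supported on segments parallel to the edges. In the second case the product
lives on the four corners only. This is impossible once the constant coefficient is nonzero, and
that coefficient is, up to sign, a monic polynomial in `lam`
(`IsPrimitiveParallelogram.eq_single_or_eq_single`).

The Nullstellensatz transfers irreducibility from `P` to its zero set, which is the Fermi variety
because `z ↦ z^q` is onto. -/

lemma monomialValue_zero (x : Torus d) : monomialValue x 0 = 1 := by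
  simp [monomialValue]

lemma monomialValue_add (x : Torus d) (α β : Fin d → ℤ) :
    monomialValue x (α + β) = monomialValue x α * monomialValue x β := by
  simp [monomialValue, zpow_add, Finset.prod_mul_distrib]

lemma monomialValue_mul (x y : Torus d) (α : Fin d → ℤ) :
    monomialValue (x * y) α = monomialValue x α * monomialValue y α := by
  simp [monomialValue, mul_zpow, Finset.prod_mul_distrib]

/-- `α ↦ x^α` as a monoid homomorphism. -/
def monomialHom (x : Torus d) : Multiplicative (Fin d → ℤ) →* ℂ where
  toFun α := monomialValue x α.toAdd
  map_one' := monomialValue_zero x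
  map_mul' α β := monomialValue_add x α.toAdd β.toAdd

/-- Evaluation of Laurent polynomials at a point of the torus, as an algebra homomorphism. -/
def valueHom (x : Torus d) : Laurent d →ₐ[ℂ] ℂ :=
  AddMonoidAlgebra.lift ℂ ℂ (Fin d → ℤ) (monomialHom x)

lemma valueHom_apply (x : Torus d) (f : Laurent d) : valueHom x f = f.value x := by
  simp [valueHom, AddMonoidAlgebra.lift_apply, Laurent.value, monomialHom]

@[simp] lemma valueHom_single (x : Torus d) (α : Fin d → ℤ) (c : ℂ) :
    valueHom x (single α c) = c * monomialValue x α := by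
  simp [valueHom, monomialHom]

lemma isUnit_single (α : Fin d → ℤ) {c : ℂ} (hc : c ≠ 0) : IsUnit (single α c : Laurent d) := by
  refine IsUnit.of_mul_eq_one (single (-α) c⁻¹) ?_
  rw [single_mul_single, add_neg_cancel, mul_inv_cancel₀ hc, one_def]

/-- A Laurent polynomial is determined by its values on the torus. -/
lemma laurent_ext_value {f g : Laurent d} (h : ∀ x, f.value x = g.value x) : f = g := by
  let χ : (Fin d → ℤ) → (Torus d →* ℂ) := fun α =>
    { toFun := fun x => monomialValue x α
      map_one' := by simp [monomialValue]
      map_mul' := fun x y => monomialValue_mul x y α }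
  have hinj : Function.Injective χ := by
    intro α β hab
    funext i
    -- Evaluate at the point with `i`-th coordinate 2 and all others 1: powers of 2 determine the
    -- exponent.
    have h2 := DFunLike.congr_fun hab (Pi.mulSingle i (Units.mk0 (2 : ℂ) two_ne_zero))
    have key : ∀ γ : Fin d → ℤ,
        χ γ (Pi.mulSingle i (Units.mk0 (2 : ℂ) two_ne_zero)) = (2 : ℂ) ^ γ i := by
      intro γ
      change monomialValue _ γ = _
      rw [monomialValue, Finset.prod_eq_single i]
      · simp
      · intro j _ hj
        simp [Pi.mulSingle_eq_of_ne hj]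
      · simp
    rw [key, key] at h2
    have h3 : ((2 : ℝ) ^ α i) = (2 : ℝ) ^ β i := by
      have h3 := congrArg (fun z : ℂ => ‖z‖) h2
      simpa using h3
    exact zpow_right_injective₀ (by norm_num) (by norm_num) h3
  -- Dedekind: distinct characters of the torus are linearly independent.
  have hli := (linearIndependent_monoidHom (Torus d) ℂ).comp χ hinj
  rw [linearIndependent_iff_injective_finsuppLinearCombination] at hli
  have h0 : f.coeff = g.coeff := by
    apply hli
    funext x
    have := h x
    simpa [Finsupp.linearCombination_apply, Finsupp.sum, Laurent.value, Finset.sum_apply, χ]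
      using this
  exact AddMonoidAlgebra.ext h0

end Value

/-! ### From irreducible Laurent polynomials to irreducible hypersurfaces. -/

section Nullstellensatz

variable {d : ℕ}

/-- The inclusion of polynomials into Laurent polynomials. -/
def toLaurent (d : ℕ) : MvPolynomial (Fin d) ℂ →ₐ[ℂ] Laurent d :=
  MvPolynomial.aeval fun i => single (Pi.single i 1) 1

lemma valueHom_toLaurent (x : Torus d) (p : MvPolynomial (Fin d) ℂ) :
    valueHom x (toLaurent d p) = MvPolynomial.aeval (fun i => (x i : ℂ)) p := by
  have : (valueHom x).comp (toLaurent d) = MvPolynomial.aeval (fun i => (x i : ℂ)) := by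
    ext i
    simp only [toLaurent, AlgHom.comp_apply, MvPolynomial.aeval_X, valueHom_single, one_mul]
    rw [monomialValue, Finset.prod_eq_single i]
    · simp
    · intro j _ hj
      simp [Pi.single_eq_of_ne hj]
    · simp
  exact DFunLike.congr_fun this p

lemma isUnit_toLaurent_X (i : Fin d) : IsUnit (toLaurent d (MvPolynomial.X i)) := by
  simpa [toLaurent] using isUnit_single (Pi.single i 1) one_ne_zero

lemma toLaurent_monomial (α : Fin d → ℕ) :
    toLaurent d (∏ i, MvPolynomial.X i ^ α i) = single (fun i => (α i : ℤ)) 1 := by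
  have h : ∀ i, (single (Pi.single i 1) 1 : Laurent d) ^ α i = single (Pi.single i (α i : ℤ)) 1 := by
    intro i
    rw [single_pow, one_pow, ← Pi.single_smul]
    simp
  simp only [map_prod, map_pow, toLaurent, MvPolynomial.aeval_X, h]
  have h2 : ∀ s : Finset (Fin d), ∏ i ∈ s, (single (Pi.single i (α i : ℤ)) 1 : Laurent d)
      = single (∑ i ∈ s, Pi.single i (α i : ℤ)) 1 := by
    intro s
    induction s using Finset.induction_on with
    | empty => simp [one_def]
    | insert a s ha ih => rw [Finset.prod_insert ha, Finset.sum_insert ha, ih, single_mul_single, one_mul]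
  rw [h2, Finset.univ_sum_single]

/-- Up to a unit, every Laurent polynomial is a polynomial. -/
lemma exists_toLaurent_eq (f : Laurent d) :
    ∃ (p : MvPolynomial (Fin d) ℂ) (u : Laurent d), IsUnit u ∧ toLaurent d p = u * f := by
  suffices H : ∃ (p : MvPolynomial (Fin d) ℂ) (m : Fin d → ℕ),
      toLaurent d p = single (fun i => (m i : ℤ)) 1 * f by
    obtain ⟨p, m, h⟩ := H
    exact ⟨p, _, isUnit_single _ one_ne_zero, h⟩
  induction f using AddMonoidAlgebra.induction_linear with
  | zero => exact ⟨0, 0, by simp⟩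
  | add f g hf hg =>
    obtain ⟨p, m, hp⟩ := hf
    obtain ⟨r, n, hr⟩ := hg
    refine ⟨(∏ i, MvPolynomial.X i ^ n i) * p + (∏ i, MvPolynomial.X i ^ m i) * r, m + n, ?_⟩
    have hs : (single (fun i => ((m + n) i : ℤ)) 1 : Laurent d)
        = single (fun i => (m i : ℤ)) 1 * single (fun i => (n i : ℤ)) 1 := by
      rw [single_mul_single, one_mul]
      congr 1
    rw [map_add, map_mul, map_mul, toLaurent_monomial, toLaurent_monomial, hp, hr, hs]
    ring
  | single α c =>
    refine ⟨MvPolynomial.C c * ∏ i, MvPolynomial.X i ^ (α i + |α i|).toNat,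
      fun i => (|α i|).toNat, ?_⟩
    rw [map_mul, toLaurent_monomial, single_mul_single, one_mul,
      ← MvPolynomial.algebraMap_eq, AlgHom.commutes, AddMonoidAlgebra.coe_algebraMap]
    simp only [Function.comp, single_mul_single, zero_add, mul_one, Algebra.algebraMap_self,
      RingHom.id_apply]
    congr 1
    funext i
    have h1 := neg_abs_le (α i)
    have h2 := abs_nonneg (α i)
    simp only [Pi.add_apply]
    omega

/-- Clear denominators and factor into primes of the polynomial ring. Since the image is
irreducible, all prime factors but one become units, and the remaining one is `r`. -/
lemma exists_prime_associated {P : Laurent d} (hP : Irreducible P) :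
    ∃ r : MvPolynomial (Fin d) ℂ, Prime r ∧ Associated (toLaurent d r) P := by
  obtain ⟨p, u, hu, hp⟩ := exists_toLaurent_eq P
  have hirr : Irreducible (toLaurent d p) := by rwa [hp, irreducible_isUnit_mul hu]
  have hass : Associated (toLaurent d p) P := by
    rw [hp]; exact associated_unit_mul_left P u hu
  suffices H : ∀ p : MvPolynomial (Fin d) ℂ, Irreducible (toLaurent d p) →
      ∃ r, Prime r ∧ Associated (toLaurent d r) (toLaurent d p) by
    obtain ⟨r, hr, h⟩ := H p hirr
    exact ⟨r, hr, h.trans hass⟩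
  intro p
  induction p using UniqueFactorizationMonoid.induction_on_prime with
  | h₁ => intro h; simp at h
  | h₂ x hx => intro h; exact absurd (hx.map (toLaurent d)) h.not_isUnit
  | h₃ a r _ hr ih =>
    intro h
    rw [map_mul] at h ⊢
    rcases h.isUnit_or_isUnit rfl with h1 | h1
    · obtain ⟨t, ht, h2⟩ := ih ((irreducible_isUnit_mul h1).1 h)
      exact ⟨t, ht, h2.trans (associated_unit_mul_right _ _ h1)⟩
    · exact ⟨r, hr, associated_mul_unit_right _ _ h1⟩

/-- **Nullstellensatz** on the torus for an irreducible hypersurface. -/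
lemma dvd_or_dvd_of_value_eq_zero {P f g : Laurent d} (hP : Irreducible P)
    (h : ∀ x : Torus d, P.value x = 0 → f.value x * g.value x = 0) : P ∣ f ∨ P ∣ g := by
  obtain ⟨r, hr, hrP⟩ := exists_prime_associated hP
  obtain ⟨p₁, u₁, hu₁, h₁⟩ := exists_toLaurent_eq f
  obtain ⟨p₂, u₂, hu₂, h₂⟩ := exists_toLaurent_eq g
  have hprime : (Ideal.span {r}).IsPrime := (Ideal.span_singleton_prime hr.ne_zero).2 hr
  -- The hypothesis says nothing about zeros of `r` on the coordinate hyperplanes; the factor `∏ X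
  -- i` vanishes there.
  have hmem : (∏ i, MvPolynomial.X i) * (p₁ * p₂) ∈ Ideal.span {r} := by
    rw [← MvPolynomial.IsPrime.vanishingIdeal_zeroLocus (K := ℂ) (Ideal.span {r}),
      MvPolynomial.mem_vanishingIdeal_iff]
    intro y hy
    have hry : MvPolynomial.aeval y r = 0 :=
      (MvPolynomial.mem_zeroLocus_iff.1 hy) r (Ideal.mem_span_singleton_self r)
    by_cases hy0 : ∃ i, y i = 0
    · obtain ⟨i, hi⟩ := hy0
      rw [map_mul, map_prod, Finset.prod_eq_zero (Finset.mem_univ i) (by simpa using hi), zero_mul]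
    · push Not at hy0
      let x : Torus d := fun i => Units.mk0 (y i) (hy0 i)
      have hx : ∀ p : MvPolynomial (Fin d) ℂ,
          MvPolynomial.aeval y p = valueHom x (toLaurent d p) := fun p =>
        (valueHom_toLaurent x p).symm
      have hPx : P.value x = 0 := by
        obtain ⟨v, hv⟩ := hrP
        rw [← valueHom_apply, ← hv, map_mul, ← hx, hry, zero_mul]
      rw [map_mul, map_mul, hx p₁, hx p₂, h₁, h₂, map_mul, map_mul, valueHom_apply x f,
        valueHom_apply x g]
      linear_combination (MvPolynomial.aeval y (∏ i, MvPolynomial.X i : MvPolynomial (Fin d) ℂ)) * valueHom x u₁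
        * valueHom x u₂ * h x hPx
  have hdvd : ∀ {p : MvPolynomial (Fin d) ℂ} {f u : Laurent d}, IsUnit u → toLaurent d p = u * f →
      r ∣ p → P ∣ f := by
    intro p f u hu hp hrp
    have := map_dvd (toLaurent d) hrp
    rw [hp, hu.dvd_mul_left] at this
    exact hrP.dvd_iff_dvd_left.1 this
  rw [Ideal.mem_span_singleton] at hmem
  rcases hr.dvd_or_dvd hmem with h3 | h3
  -- If `r` divided a variable, its image, hence `P`, would be a unit.
  · obtain ⟨i, -, hi⟩ := (Prime.dvd_finsetProd_iff hr _).1 h3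
    exact absurd (hrP.isUnit_iff.1 (isUnit_of_dvd_unit (map_dvd (toLaurent d) hi)
      (isUnit_toLaurent_X i))) hP.not_isUnit
  · rcases hr.dvd_or_dvd h3 with h4 | h4
    · exact Or.inl (hdvd hu₁ h₁ h4)
    · exact Or.inr (hdvd hu₂ h₂ h4)

/-- The zero set of an irreducible Laurent polynomial is an irreducible variety. -/
theorem isIrreducibleVariety_of_irreducible {P : Laurent d} (hP : Irreducible P) :
    IsIrreducibleVariety {x : Torus d | P.value x = 0} := by
  have hzero : ∀ {f : Laurent d}, P ∣ f → ∀ x : Torus d, P.value x = 0 → f.value x = 0 := by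
    rintro _ ⟨g, rfl⟩ x hx
    rw [← valueHom_apply, map_mul, valueHom_apply, hx, zero_mul]
  refine ⟨?_, ⟨{P}, by simp⟩, ?_⟩
  · by_contra hne
    rw [Set.not_nonempty_iff_eq_empty, Set.eq_empty_iff_forall_notMem] at hne
    -- With no zeros the hypothesis is vacuous, so `P` would divide 1.
    have := dvd_or_dvd_of_value_eq_zero (f := 1) (g := 1) hP fun x hx => absurd hx (hne x)
    exact hP.not_isUnit (isUnit_of_dvd_one (or_self_iff.1 this))
  · rintro _ _ ⟨S, rfl⟩ ⟨T, rfl⟩ hsub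
    by_contra! hcon
    obtain ⟨h1, h2⟩ := hcon
    rw [Set.not_subset] at h1 h2
    obtain ⟨x, hx, hx'⟩ := h1
    obtain ⟨y, hy, hy'⟩ := h2
    simp only [Set.mem_ofPred_eq, not_forall] at hx' hy'
    obtain ⟨f, hf, hfx⟩ := hx'
    obtain ⟨g, hg, hgy⟩ := hy'
    rcases dvd_or_dvd_of_value_eq_zero (f := f) (g := g) hP (fun z hz => by
      rcases hsub hz with h | h
      · rw [h f hf, zero_mul]
      · rw [h g hg, mul_zero]) with h | h
    · exact hfx (hzero h x hx)
    · exact hgy (hzero h y hy)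

end Nullstellensatz

/-! ### Newton polygons and factorizations. -/

section Newton

variable {G : Type*} [AddCommGroup G]

lemma exists_add_eq_of_mem_support_mul {f g : AddMonoidAlgebra ℂ G} {γ : G}
    (h : γ ∈ (f * g).coeff.support) :
    ∃ α ∈ f.coeff.support, ∃ β ∈ g.coeff.support, α + β = γ := by
  classical
  simpa [Finset.mem_add] using AddMonoidAlgebra.support_coeff_mul_subset f g h

/-- `α` is the exponent of the leading term of `f` for the lexicographic order given by `ℓ`, then
`m`. -/
structure IsLexMax (ℓ m : G →+ ℤ) (f : AddMonoidAlgebra ℂ G) (α : G) : Prop where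
  mem : α ∈ f.coeff.support
  le : ∀ β ∈ f.coeff.support, ℓ β < ℓ α ∨ (ℓ β = ℓ α ∧ m β ≤ m α)

lemma IsLexMax.fst_le {ℓ m : G →+ ℤ} {f : AddMonoidAlgebra ℂ G} {α β : G}
    (h : IsLexMax ℓ m f α) (hβ : β ∈ f.coeff.support) : ℓ β ≤ ℓ α := by
  rcases h.le β hβ with h | h <;> omega

lemma exists_isLexMax (ℓ m : G →+ ℤ) {f : AddMonoidAlgebra ℂ G} (hf : f ≠ 0) :
    ∃ α, IsLexMax ℓ m f α := by
  have hne : f.coeff.support.Nonempty := by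
    rw [Finsupp.support_nonempty_iff]
    simpa using hf
  obtain ⟨α, hα, hmax⟩ := Finset.exists_max_image f.coeff.support
    (fun α => toLex (ℓ α, m α)) hne
  refine ⟨α, hα, fun β hβ => ?_⟩
  simpa [Prod.Lex.toLex_le_toLex] using hmax β hβ

/-- By `hinj` the order separates exponents, so the leading exponent of the product arises in one
way only and its coefficient is a product of nonzero numbers. -/
lemma IsLexMax.mul {ℓ m : G →+ ℤ} (hinj : ∀ x, ℓ x = 0 → m x = 0 → x = 0)
    {f g : AddMonoidAlgebra ℂ G} {α β : G} (hf : IsLexMax ℓ m f α) (hg : IsLexMax ℓ m g β) :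
    IsLexMax ℓ m (f * g) (α + β) := by
  constructor
  · have hu : UniqueAdd f.coeff.support g.coeff.support α β := by
      intro a b ha hb hab
      have h1 := congrArg ℓ hab
      have h2 := congrArg m hab
      rw [map_add, map_add] at h1 h2
      have h3 := hf.le a ha
      have h4 := hg.le b hb
      have h5 : a - α = 0 := by
        apply hinj <;> rw [map_sub] <;> omega
      have h6 : a = α := sub_eq_zero.1 h5
      subst h6
      exact ⟨rfl, add_left_cancel hab⟩
    rw [Finsupp.mem_support_iff, coeff_mul_add_of_uniqueAdd hu]
    exact mul_ne_zero (Finsupp.mem_support_iff.1 hf.mem) (Finsupp.mem_support_iff.1 hg.mem)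
  · intro γ hγ
    obtain ⟨a, ha, b, hb, rfl⟩ := exists_add_eq_of_mem_support_mul hγ
    have h3 := hf.le a ha
    have h4 := hg.le b hb
    simp only [map_add]
    omega

lemma IsLexMax.values_eq {ℓ m : G →+ ℤ} {f : AddMonoidAlgebra ℂ G} {α β : G}
    (hα : IsLexMax ℓ m f α) (hβ : IsLexMax ℓ m f β) : ℓ α = ℓ β ∧ m α = m β := by
  have h1 := hα.le β hβ.mem
  have h2 := hβ.le α hα.mem
  omega

/-- If a Newton polygon in the strip `|d| ≤ Q` has the primitive edge from `(s, d) = (Q, -Q)` to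
`(Q, Q)`, then this edge belongs to one factor and `d` is constant on the other. -/
lemma const_of_primitive_edge {s d : G →+ ℤ} (hinj : ∀ x, s x = 0 → d x = 0 → x = 0) {Q : ℤ}
    (hQ : 0 < Q) (hs : ∀ x, s x = 0 → 2 * Q ∣ d x) {f g : AddMonoidAlgebra ℂ G}
    (hbd : ∀ α ∈ (f * g).coeff.support, |s α| ≤ Q ∧ |d α| ≤ Q) {A B : G}
    (hA : A ∈ (f * g).coeff.support) (hAs : s A = Q) (hAd : d A = Q)
    (hB : B ∈ (f * g).coeff.support) (hBs : s B = Q) (hBd : d B = -Q) :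
    (∀ β ∈ g.coeff.support, ∀ β' ∈ g.coeff.support, d β = d β') ∨
      (∀ β ∈ f.coeff.support, ∀ β' ∈ f.coeff.support, d β = d β') := by
  have hf0 : f ≠ 0 := by rintro rfl; simp at hA
  have hg0 : g ≠ 0 := by rintro rfl; simp at hA
  have hbd' : ∀ α ∈ (f * g).coeff.support, s α ≤ Q ∧ -Q ≤ d α ∧ d α ≤ Q := fun α hα => by
    have h1 := abs_le.1 (hbd α hα).1
    have h2 := abs_le.1 (hbd α hα).2
    omega
  have hdinj : ∀ x, d x = 0 → s x = 0 → x = 0 := fun x h1 h2 => hinj x h2 h1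
  -- `A` and `B` are the ends of the face where `s` is maximal, and they also realize the maximum
  -- and minimum of `d`. Both the face length and the total `d`-width are additive over the factors.
  have L1 : IsLexMax s d (f * g) A := ⟨hA, fun β hβ => by have := hbd' β hβ; omega⟩
  have L2 : IsLexMax s (-d) (f * g) B := ⟨hB, fun β hβ => by
    have := hbd' β hβ; simp only [AddMonoidHom.neg_apply]; omega⟩
  have L3 : IsLexMax d s (f * g) A := ⟨hA, fun β hβ => by have := hbd' β hβ; omega⟩
  have L4 : IsLexMax (-d) s (f * g) B := ⟨hB, fun β hβ => by
    have := hbd' β hβ; simp only [AddMonoidHom.neg_apply]; omega⟩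
  obtain ⟨af, haf⟩ := exists_isLexMax s d hf0
  obtain ⟨ag, hag⟩ := exists_isLexMax s d hg0
  obtain ⟨bf, hbf⟩ := exists_isLexMax s (-d) hf0
  obtain ⟨bg, hbg⟩ := exists_isLexMax s (-d) hg0
  obtain ⟨cf, hcf⟩ := exists_isLexMax d s hf0
  obtain ⟨cg, hcg⟩ := exists_isLexMax d s hg0
  obtain ⟨ef, hef⟩ := exists_isLexMax (-d) s hf0
  obtain ⟨eg, heg⟩ := exists_isLexMax (-d) s hg0
  have E1 := (haf.mul hinj hag).values_eq L1
  have E2 := (hbf.mul (fun x h1 h2 => hinj x h1 (by simpa using h2)) hbg).values_eq L2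
  have E3 := (hcf.mul hdinj hcg).values_eq L3
  have E4 := (hef.mul (fun x h1 h2 => hdinj x (by simpa using h1) h2) heg).values_eq L4
  simp only [map_add, AddMonoidHom.neg_apply] at E1 E2 E3 E4
  have hle : ∀ {h : AddMonoidAlgebra ℂ G} {α β : G}, IsLexMax (-d) s h α → β ∈ h.coeff.support →
      d α ≤ d β := by
    intro h α β h1 h2
    have := h1.fst_le h2
    simp only [AddMonoidHom.neg_apply] at this
    omega
  have F1 := haf.le bf hbf.mem
  have F2 := hbf.fst_le haf.mem
  have F3 := hag.le bg hbg.mem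
  have F4 := hbg.fst_le hag.mem
  -- The `s`-maximal faces of `f` and `g` have `d`-lengths `2Qk` and `2Ql`, summing to `2Q`. The
  -- factor with the full length exhausts the `d`-width, so the other has width 0.
  obtain ⟨k, hk⟩ := hs (af - bf) (by rw [map_sub]; omega)
  obtain ⟨l, hl⟩ := hs (ag - bg) (by rw [map_sub]; omega)
  rw [map_sub] at hk hl
  have hk0 : 0 ≤ k := nonneg_of_mul_nonneg_right (a := 2 * Q) (by omega) (by omega)
  have hl0 : 0 ≤ l := nonneg_of_mul_nonneg_right (a := 2 * Q) (by omega) (by omega)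
  have hkl : k + l = 1 := by
    have : 2 * Q * (k + l) = 2 * Q * 1 := by linarith [E1.2, E2.2]
    exact mul_left_cancel₀ (by omega) this
  rcases (by omega : k = 1 ∨ l = 1) with rfl | rfl
  · left
    have key : ∀ β ∈ g.coeff.support, d β = d eg := by
      intro β hβ
      have h1 := hcf.fst_le haf.mem
      have h2 := hle hef hbf.mem
      have h3 := hcg.fst_le hβ
      have h4 := hle heg hβ
      linarith [E3.1, E4.1]
    intro β hβ β' hβ'
    rw [key β hβ, key β' hβ']
  · right
    have key : ∀ β ∈ f.coeff.support, d β = d ef := by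
      intro β hβ
      have h1 := hcg.fst_le hag.mem
      have h2 := hle heg hbg.mem
      have h3 := hcf.fst_le hβ
      have h4 := hle hef hβ
      linarith [E3.1, E4.1]
    intro β hβ β' hβ'
    rw [key β hβ, key β' hβ']

lemma eq_single_of_const {s d : G →+ ℤ} (hinj : ∀ x, s x = 0 → d x = 0 → x = 0)
    {f : AddMonoidAlgebra ℂ G} (hf : f ≠ 0)
    (hs : ∀ β ∈ f.coeff.support, ∀ β' ∈ f.coeff.support, s β = s β')
    (hd : ∀ β ∈ f.coeff.support, ∀ β' ∈ f.coeff.support, d β = d β') :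
    ∃ α c, c ≠ 0 ∧ f = single α c := by
  have hne : f.coeff.support.Nonempty := by
    rw [Finsupp.support_nonempty_iff]
    simpa using hf
  obtain ⟨α, hα⟩ := hne
  refine ⟨α, f.coeff α, Finsupp.mem_support_iff.1 hα, ?_⟩
  ext β
  by_cases hβ : β ∈ f.coeff.support
  · have : β - α = 0 := by
      apply hinj <;> rw [map_sub, sub_eq_zero]
      exacts [hs β hβ α hα, hd β hβ α hα]
    rw [sub_eq_zero.1 this]
    simp
  · have hne : α ≠ β := by rintro rfl; exact hβ hα
    rw [Finsupp.notMem_support_iff.1 hβ]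
    simp [hne]

/-- In the coordinates `(s, d)` the Newton polygon of `P` is the square with vertices `(±Q, ±Q)`,
and the edges of this square are primitive, i.e. have no lattice points but their end points. -/
structure IsPrimitiveParallelogram (s d : G →+ ℤ) (Q : ℤ) (P : AddMonoidAlgebra ℂ G) :
    Prop where
  eq_zero : ∀ x, s x = 0 → d x = 0 → x = 0
  pos : 0 < Q
  dvd_snd : ∀ x, s x = 0 → 2 * Q ∣ d x
  dvd_fst : ∀ x, d x = 0 → 2 * Q ∣ s x
  bound : ∀ α ∈ P.coeff.support, |s α| ≤ Q ∧ |d α| ≤ Q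
  vertex : ∀ a b : ℤ, |a| = Q → |b| = Q → ∃ α ∈ P.coeff.support, s α = a ∧ d α = b

/-- Primitivity makes the values of `d` on `f` congruent modulo `2Q`, and `g` only shifts them. But
`d` is 0 at the origin and `Q` at a corner. -/
lemma IsPrimitiveParallelogram.not_mul_segments {s d : G →+ ℤ} {Q : ℤ}
    {f g : AddMonoidAlgebra ℂ G} (h : IsPrimitiveParallelogram s d Q (f * g))
    (h0 : (0 : G) ∈ (f * g).coeff.support)
    (hs : ∀ β ∈ f.coeff.support, ∀ β' ∈ f.coeff.support, s β = s β')
    (hd : ∀ β ∈ g.coeff.support, ∀ β' ∈ g.coeff.support, d β = d β') : False := by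
  have hQ := h.pos
  obtain ⟨A, hA, -, hAd⟩ := h.vertex Q Q (abs_of_pos hQ) (abs_of_pos hQ)
  obtain ⟨α, hα, β, hβ, hab⟩ := exists_add_eq_of_mem_support_mul h0
  obtain ⟨α', hα', β', hβ', rfl⟩ := exists_add_eq_of_mem_support_mul hA
  obtain ⟨k, hk⟩ := h.dvd_snd (α' - α) (by rw [map_sub, hs α' hα' α hα, sub_self])
  have h1 := congrArg d hab
  rw [map_add, map_zero] at h1
  rw [map_add] at hAd
  have h2 := hd β hβ β' hβ'
  rw [map_sub] at hk
  have h3 : Q * (2 * k) = Q * 1 := by linarith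
  have := mul_left_cancel₀ hQ.ne' h3
  omega

/-- Two adjacent edges suffice: each forces one coordinate to be constant on one factor. If it is
the same factor twice, that factor is a monomial; otherwise the factors are transverse segments. -/
theorem IsPrimitiveParallelogram.eq_single_or_eq_single {s d : G →+ ℤ} {Q : ℤ}
    {f g : AddMonoidAlgebra ℂ G} (h : IsPrimitiveParallelogram s d Q (f * g))
    (h0 : (0 : G) ∈ (f * g).coeff.support) :
    (∃ α c, c ≠ 0 ∧ f = single α c) ∨ (∃ α c, c ≠ 0 ∧ g = single α c) := by
  have hQ := h.pos
  have hf0 : f ≠ 0 := by rintro rfl; simp at h0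
  have hg0 : g ≠ 0 := by rintro rfl; simp at h0
  have habs : |Q| = Q := abs_of_pos hQ
  have habs' : |-Q| = Q := by rw [abs_neg, habs]
  obtain ⟨A, hA, hAs, hAd⟩ := h.vertex Q Q habs habs
  obtain ⟨B, hB, hBs, hBd⟩ := h.vertex Q (-Q) habs habs'
  obtain ⟨D, hD, hDs, hDd⟩ := h.vertex (-Q) Q habs' habs
  have h1 := const_of_primitive_edge h.eq_zero hQ h.dvd_snd h.bound hA hAs hAd hB hBs hBd
  have h2 := const_of_primitive_edge (fun x hd hs => h.eq_zero x hs hd) hQ h.dvd_fst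
    (fun α hα => (h.bound α hα).symm) hA hAd hAs hD hDd hDs
  rcases h1 with h1 | h1 <;> rcases h2 with h2 | h2
  · exact Or.inr (eq_single_of_const h.eq_zero hg0 h2 h1)
  · exact (h.not_mul_segments h0 h2 h1).elim
  · rw [mul_comm] at h h0
    exact (h.not_mul_segments h0 h2 h1).elim
  · exact Or.inl (eq_single_of_const h.eq_zero hf0 h2 h1)

/-- The `s`-width is additive under multiplication; it is positive for `P` and zero for 1. -/
lemma IsPrimitiveParallelogram.not_isUnit {s d : G →+ ℤ} {Q : ℤ} {P : AddMonoidAlgebra ℂ G}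
    (h : IsPrimitiveParallelogram s d Q P) : ¬ IsUnit P := by
  intro hu
  obtain ⟨u, hu⟩ := hu.exists_right_inv
  have hQ := h.pos
  have hu0 : u ≠ 0 := by rintro rfl; simp at hu
  have hP0 : P ≠ 0 := by rintro rfl; simp at hu
  obtain ⟨A, hA, hAs, -⟩ := h.vertex Q Q (abs_of_pos hQ) (abs_of_pos hQ)
  obtain ⟨C, hC, hCs, -⟩ := h.vertex (-Q) Q (by rw [abs_neg, abs_of_pos hQ]) (abs_of_pos hQ)
  obtain ⟨p, hp⟩ := exists_isLexMax s d hP0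
  obtain ⟨v, hv⟩ := exists_isLexMax s d hu0
  obtain ⟨p', hp'⟩ := exists_isLexMax (-s) d hP0
  obtain ⟨v', hv'⟩ := exists_isLexMax (-s) d hu0
  have h1 := (hp.mul h.eq_zero hv).mem
  have h2 := (hp'.mul (fun x hx => h.eq_zero x (by simpa using hx)) hv').mem
  have hone : ∀ x ∈ (1 : AddMonoidAlgebra ℂ G).coeff.support, x = 0 := by
    intro x hx
    simpa [one_def] using hx
  rw [hu] at h1 h2
  have e1 := congrArg s (hone _ h1)
  have e2 := congrArg s (hone _ h2)
  rw [map_add, map_zero] at e1 e2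
  have b1 := hp.fst_le hA
  have b2 := hp'.fst_le hC
  have b3 := hv.fst_le hv'.mem
  simp only [AddMonoidHom.neg_apply] at b2
  omega

end Newton

theorem IsPrimitiveParallelogram.irreducible {n : ℕ} {s d : (Fin n → ℤ) →+ ℤ} {Q : ℤ}
    {P : Laurent n} (h : IsPrimitiveParallelogram s d Q P) (h0 : P.coeff 0 ≠ 0) :
    Irreducible P := by
  refine ⟨h.not_isUnit, ?_⟩
  rintro f g rfl
  rcases h.eq_single_or_eq_single (Finsupp.mem_support_iff.2 h0) with
    ⟨α, c, hc, rfl⟩ | ⟨α, c, hc, rfl⟩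
  · exact Or.inl (isUnit_single α hc)
  · exact Or.inr (isUnit_single α hc)

/-! ### Extreme and constant coefficients of determinants. -/

section DetSupport

/-- The coefficient at `γ` as an additive homomorphism. -/
def coeffHom {G : Type*} (γ : G) : AddMonoidAlgebra ℂ G →+ ℂ :=
  (Finsupp.applyAddHom γ).comp coeffAddEquiv.toAddMonoidHom

lemma coeffHom_apply {G : Type*} (γ : G) (f : AddMonoidAlgebra ℂ G) : coeffHom γ f = f.coeff γ := rfl

variable {G : Type*} [AddCommGroup G] {n : Type*} [Fintype n] [DecidableEq n]

lemma coeff_det (A : Matrix n n (AddMonoidAlgebra ℂ G)) (γ : G) :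
    A.det.coeff γ =
      ∑ σ : Equiv.Perm n, ((Equiv.Perm.sign σ : ℤ) : ℂ) * (∏ i, A (σ i) i).coeff γ := by
  rw [← coeffHom_apply, Matrix.det_apply', map_sum]
  refine Finset.sum_congr rfl fun σ _ => ?_
  rw [← zsmul_eq_mul, map_zsmul, zsmul_eq_mul, coeffHom_apply]

lemma le_of_mem_support_prod {ι : Type*} (φ : G →+ ℤ) (t : Finset ι)
    (f : ι → AddMonoidAlgebra ℂ G) (h : ∀ i, ∀ α ∈ (f i).coeff.support, φ α ≤ 1) :
    ∀ α ∈ (∏ i ∈ t, f i).coeff.support, φ α ≤ t.card := by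
  classical
  induction t using Finset.induction_on with
  | empty =>
    intro α hα
    have : α = 0 := by simpa [one_def] using hα
    simp [this]
  | insert a t ha ih =>
    intro γ hγ
    rw [Finset.prod_insert ha] at hγ
    obtain ⟨α, hα, β, hβ, rfl⟩ := exists_add_eq_of_mem_support_mul hγ
    have h1 := h a α hα
    have h2 := ih β hβ
    rw [map_add, Finset.card_insert_of_notMem ha]
    push_cast
    omega

lemma le_of_mem_support_det (φ : G →+ ℤ) (A : Matrix n n (AddMonoidAlgebra ℂ G))
    (h : ∀ i j, ∀ α ∈ (A i j).coeff.support, φ α ≤ 1) :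
    ∀ α ∈ A.det.coeff.support, φ α ≤ Fintype.card n := by
  intro α hα
  by_contra hlt
  rw [Finsupp.mem_support_iff, coeff_det] at hα
  refine hα (Finset.sum_eq_zero fun σ _ => ?_)
  rw [Finsupp.notMem_support_iff.1 fun hmem => hlt
    (le_of_mem_support_prod φ Finset.univ _ (fun i => h (σ i) i) α hmem), mul_zero]

/-- If `v` is the only exponent of the factors with maximal `φ`-value `1`, the leading coefficient
of a product is the product of the leading coefficients. -/
lemma coeff_prod_top {ι : Type*} (φ : G →+ ℤ) (v : G) (hv : φ v = 1) (t : Finset ι)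
    (f : ι → AddMonoidAlgebra ℂ G)
    (h : ∀ i, ∀ α ∈ (f i).coeff.support, φ α ≤ 1 ∧ (φ α = 1 → α = v)) :
    (∀ α ∈ (∏ i ∈ t, f i).coeff.support, φ α = t.card → α = t.card • v) ∧
      (∏ i ∈ t, f i).coeff (t.card • v) = ∏ i ∈ t, (f i).coeff v := by
  classical
  induction t using Finset.induction_on with
  | empty =>
    refine ⟨fun α hα _ => ?_, by simp [one_def]⟩
    have : α = 0 := by simpa [one_def] using hα
    simp [this]
  | insert a t ha ih =>
    obtain ⟨ih1, ih2⟩ := ih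
    have hle := le_of_mem_support_prod φ t f (fun i α hα => (h i α hα).1)
    rw [Finset.prod_insert ha, Finset.prod_insert ha, Finset.card_insert_of_notMem ha]
    have key : ∀ α ∈ (f a).coeff.support, ∀ β ∈ (∏ i ∈ t, f i).coeff.support,
        φ α + φ β = t.card + 1 → α = v ∧ β = t.card • v := by
      intro α hα β hβ hsum
      have h1 := h a α hα
      have h2 := hle β hβ
      exact ⟨h1.2 (by omega), ih1 β hβ (by omega)⟩
    constructor
    · intro γ hγ hφ
      obtain ⟨α, hα, β, hβ, rfl⟩ := exists_add_eq_of_mem_support_mul hγ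
      rw [map_add] at hφ
      obtain ⟨rfl, rfl⟩ := key α hα β hβ (by rw [hφ]; push_cast; rfl)
      rw [succ_nsmul']
    · have hu : UniqueAdd (f a).coeff.support (∏ i ∈ t, f i).coeff.support v (t.card • v) := by
        intro α β hα hβ hab
        refine key α hα β hβ ?_
        rw [← map_add, hab, map_add, map_nsmul, hv]
        simp [add_comm]
      rw [succ_nsmul', coeff_mul_add_of_uniqueAdd hu, ih2]

/-- In each Leibniz term the extreme exponent is reached only by taking the `v`-coefficient of every
factor. -/
lemma coeff_det_top (φ : G →+ ℤ) (v : G) (hv : φ v = 1) (A : Matrix n n (AddMonoidAlgebra ℂ G))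
    (h : ∀ i j, ∀ α ∈ (A i j).coeff.support, φ α ≤ 1 ∧ (φ α = 1 → α = v)) :
    A.det.coeff (Fintype.card n • v) = (A.map fun f => f.coeff v).det := by
  rw [coeff_det, Matrix.det_apply']
  refine Finset.sum_congr rfl fun σ _ => ?_
  have := (coeff_prod_top φ v hv Finset.univ _ (fun i => h (σ i) i)).2
  rw [Finset.card_univ] at this
  rw [this]
  rfl

/-- The constant coefficient of `det (A - λ)` vanishes for finitely many `λ` only. -/
lemma finite_coeff_zero_det_eq_zero (A : Matrix n n (AddMonoidAlgebra ℂ G)) :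
    {lam : ℂ | (A - Matrix.scalar n (single 0 lam)).det.coeff 0 = 0}.Finite := by
  let c := A.charpoly
  -- Constant Laurent coefficients of the coefficients of the characteristic polynomial; `p` keeps
  -- the leading coefficient 1, so it is nonzero.
  let p : Polynomial ℂ :=
    ∑ k ∈ Finset.range (c.natDegree + 1), Polynomial.monomial k ((c.coeff k).coeff 0)
  have hp : p ≠ 0 := by
    intro h0
    have h1 : p.coeff c.natDegree = 1 := by
      simp only [p, Polynomial.finsetSum_coeff, Polynomial.coeff_monomial]
      rw [Finset.sum_ite_eq' , if_pos (by simp)]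
      have : c.coeff c.natDegree = 1 := A.charpoly_monic
      simp [this, one_def]
    simp [h0] at h1
  have heval : ∀ lam : ℂ, p.eval lam = (c.eval (single 0 lam)).coeff 0 := by
    intro lam
    rw [Polynomial.eval_eq_sum_range (p := c), ← coeffHom_apply, map_sum]
    simp only [p, Polynomial.eval_finsetSum, Polynomial.eval_monomial]
    refine Finset.sum_congr rfl fun k _ => ?_
    rw [single_pow, nsmul_zero, coeffHom_apply]
    rw [coeff_mul_single_zero]
    
  refine (Polynomial.finite_setOfPred_isRoot hp).subset fun lam hlam => ?_
  have hneg : A - Matrix.scalar n (single 0 lam) = -(Matrix.scalar n (single 0 lam) - A) := by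
    rw [neg_sub]
  change (A - Matrix.scalar n (single 0 lam)).det.coeff 0 = 0 at hlam
  rw [hneg, Matrix.det_neg, ← Matrix.eval_charpoly] at hlam
  change p.eval lam = 0
  rw [heval]
  rcases neg_one_pow_eq_or (AddMonoidAlgebra ℂ G) (Fintype.card n) with h | h
  · simpa [h] using hlam
  · rw [h, neg_one_mul, ← coeffHom_apply, map_neg, neg_eq_zero] at hlam
    exact hlam

/-- `det (A - λ)` vanishes for finitely many `λ` only. -/
lemma finite_det_sub_eq_zero (A : Matrix n n ℂ) :
    {lam : ℂ | (A - Matrix.scalar n lam).det = 0}.Finite := by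
  refine (Polynomial.finite_setOfPred_isRoot A.charpoly_monic.ne_zero).subset fun lam hlam => ?_
  change (A - Matrix.scalar n lam).det = 0 at hlam
  rw [← neg_sub, Matrix.det_neg, ← Matrix.eval_charpoly] at hlam
  simpa using hlam

end DetSupport

/-! ### The symbol of the Lieb lattice. -/

lemma liebCoeff_eq_zero_of_forall {i j : Fin 3} {n : Fin 2 → ℤ}
    (h : |liebBase i 0 + 2 * n 0 - liebBase j 0| + |liebBase i 1 + 2 * n 1 - liebBase j 1| ≠ 1) :
    liebCoeff i j n = 0 := by
  rw [liebCoeff, if_neg]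
  intro hadj
  apply h
  simpa [liebGraph, liebVertex] using hadj

lemma liebCoeff_eq_one {i j : Fin 3} {n : Fin 2 → ℤ}
    (h : |liebBase i 0 + 2 * n 0 - liebBase j 0| + |liebBase i 1 + 2 * n 1 - liebBase j 1| = 1) :
    liebCoeff i j n = 1 := by
  rw [liebCoeff, if_pos]
  simpa [liebGraph, liebVertex] using h

lemma symbol_lieb_eq_zero {i j : Fin 3} (z : Torus 2)
    (h : ∀ n : Fin 2 → ℤ, |liebBase i 0 + 2 * n 0 - liebBase j 0|
      + |liebBase i 1 + 2 * n 1 - liebBase j 1| ≠ 1) : symbol liebCoeff z i j = 0 := by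
  simp [symbol, liebCoeff_eq_zero_of_forall (h _)]

/-- The type-`j` vertex of cell 0 has its type-`i` neighbours in cells `0` and `-e`; the symbol
carries `z^{-n}`, so cell `-e` contributes `z^e`. -/
lemma symbol_lieb_eq {i j : Fin 3} (z : Torus 2) (e : Fin 2 → ℤ) (he : e ≠ 0)
    (h : ∀ n : Fin 2 → ℤ, |liebBase i 0 + 2 * n 0 - liebBase j 0|
      + |liebBase i 1 + 2 * n 1 - liebBase j 1| = 1 ↔ n = 0 ∨ n = -e) :
    symbol liebCoeff z i j = 1 + monomialValue z e := by
  classical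
  rw [symbol, Matrix.of_apply, finsum_eq_sum_of_support_subset (s := {0, -e})]
  · rw [Finset.sum_pair (by simpa using he), liebCoeff_eq_one ((h 0).2 (Or.inl rfl)),
      liebCoeff_eq_one ((h (-e)).2 (Or.inr rfl))]
    simp [monomialValue_zero]
  · intro n hn
    have := mt (fun h' => liebCoeff_eq_zero_of_forall (mt (h n).1 h')) (left_ne_zero_of_mul hn)
    simpa [or_iff_not_imp_left] using this

/-- The symbol of the Lieb lattice at `ω ⊙ z` as a matrix of Laurent polynomials in `z`. -/
def liebLaurent (ω : Torus 2) (i j : Fin 3) : Laurent 2 :=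
  !![0, 1 + single ![-1, 0] ((ω 0)⁻¹ : ℂ), 1 + single ![0, -1] ((ω 1)⁻¹ : ℂ);
    1 + single ![1, 0] (ω 0 : ℂ), 0, 0;
    1 + single ![0, 1] (ω 1 : ℂ), 0, 0] i j

lemma valueHom_liebLaurent (ω z : Torus 2) (i j : Fin 3) :
    valueHom z (liebLaurent ω i j) = symbol liebCoeff (ω * z) i j := by
  have key : ∀ (i j : Fin 3) (e : Fin 2 → ℤ) (c : ℂ), c = monomialValue ω e → e ≠ 0 →
      (∀ n : Fin 2 → ℤ, |liebBase i 0 + 2 * n 0 - liebBase j 0|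
        + |liebBase i 1 + 2 * n 1 - liebBase j 1| = 1 ↔ n = 0 ∨ n = -e) →
      valueHom z (1 + single e c) = symbol liebCoeff (ω * z) i j := by
    rintro i j e _ rfl he h
    rw [map_add, map_one, valueHom_single, symbol_lieb_eq (ω * z) e he h, monomialValue_mul]
  have hext : ∀ n m : Fin 2 → ℤ, n = m ↔ n 0 = m 0 ∧ n 1 = m 1 := fun n m => by
    rw [funext_iff, Fin.forall_fin_two]
  fin_cases i <;> fin_cases j
  all_goals
    simp only [Fin.zero_eta, Fin.mk_one, Fin.reduceFinMk, liebLaurent, Matrix.of_apply,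
      Matrix.cons_val, map_zero]
    first
    | refine (symbol_lieb_eq_zero _ fun n => ?_).symm
      simp only [liebBase, Matrix.cons_val, abs_eq_max_neg]
      omega
    | refine key _ _ _ _ ?_ ?_ fun n => ?_
      · simp [monomialValue]
      · simp
      · simp only [hext, liebBase, Matrix.cons_val, abs_eq_max_neg, Pi.neg_apply, Pi.zero_apply]
        omega

/-! ### Dual-lattice invariance and passage to the multipliers. -/

section Twist

variable {d : ℕ} {q : Fin d → ℕ}

lemma twist_eq_mul (n : Fin d → ℤ) (z : Torus d) : twist q n z = twist q n 1 * z := by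
  funext i
  simp [twist]

lemma twist_add (n m : Fin d → ℤ) (z : Torus d) :
    twist q (n + m) z = twist q n (twist q m z) := by
  funext i
  ext
  simp only [twist, Units.val_mul, Units.val_mk0, Pi.add_apply, Int.cast_add]
  rw [← mul_assoc, ← Complex.exp_add]
  congr 2
  ring

lemma exp_eq_one_of_dvd {k : ℕ} (hk : 0 < k) {n : ℤ} (h : (k : ℤ) ∣ n) :
    Complex.exp (2 * Real.pi * Complex.I * ((n : ℂ) / (k : ℂ))) = 1 := by
  obtain ⟨l, rfl⟩ := h
  have hk' : (k : ℂ) ≠ 0 := by exact_mod_cast hk.ne'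
  rw [Complex.exp_eq_one_iff]
  refine ⟨l, ?_⟩
  push_cast
  field_simp

lemma twist_congr (hq : ∀ i, 0 < q i) {n m : Fin d → ℤ} (h : ∀ i, (q i : ℤ) ∣ n i - m i)
    (z : Torus d) : twist q n z = twist q m z := by
  have h1 : twist q (n - m) 1 = 1 := by
    funext i
    ext
    simp only [twist, Pi.one_apply, mul_one, Units.val_mk0, Units.val_one]
    exact exp_eq_one_of_dvd (hq i) (h i)
  rw [← sub_add_cancel n m, twist_add, twist_eq_mul, h1, one_mul]

lemma fourierCoeff_congr (hq : ∀ i, 0 < q i) (g : (Fin d → ℤ) → ℂ) {n m : Fin d → ℤ}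
    (h : ∀ i, (q i : ℤ) ∣ n i - m i) : fourierCoeff q g n = fourierCoeff q g m := by
  rw [fourierCoeff, fourierCoeff]
  congr 1
  refine Finset.sum_congr rfl fun w _ => ?_
  congr 1
  rw [Complex.exp_eq_exp_iff_exists_int]
  choose k hk using h
  refine ⟨-∑ i, k i * w.toInt i, ?_⟩
  push_cast
  have : ∀ i, (n i : ℂ) * (w.toInt i : ℂ) / (q i : ℂ)
      = (m i : ℂ) * (w.toInt i : ℂ) / (q i : ℂ) + k i * w.toInt i := by
    intro i
    have hk' : (q i : ℂ) ≠ 0 := by exact_mod_cast (hq i).ne'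
    have h2 : (n i : ℂ) - m i = q i * k i := by exact_mod_cast hk i
    rw [← sub_eq_iff_eq_add', ← sub_div, ← sub_mul, h2]
    field_simp
  simp only [this, Finset.sum_add_distrib]
  ring

/-- Translating the quasimomentum by a vector of the dual lattice permutes the plane waves. -/
lemma floquetDet_twist {ν : ℕ} (hq : ∀ i, 0 < q i) (a : Fin ν → Fin ν → (Fin d → ℤ) → ℂ)
    (V : (Fin d → ℤ) → Fin ν → ℂ) (lam : ℂ) (c : Cell q) (z : Torus d) :
    floquetDet q a V lam (twist q c.toInt z) = floquetDet q a V lam z := by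
  have : ∀ i, NeZero (q i) := fun i => ⟨(hq i).ne'⟩
  -- Addition in the cell wraps around. This is harmless: twists and Fourier coefficients depend on
  -- indices modulo `q` only, and `blockB` depends on differences.
  let e : Cell q × Fin ν ≃ Cell q × Fin ν := (Equiv.addRight c).prodCongr (Equiv.refl _)
  have hadd : ∀ w : Cell q, ∀ i, (q i : ℤ) ∣ (w + c).toInt i - (w.toInt + c.toInt) i := by
    intro w i
    simp only [Cell.toInt, Pi.add_apply, Fin.val_add]
    push_cast
    rw [← Int.emod_emod_of_dvd _ (dvd_refl (q i : ℤ))]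
    exact Int.ModEq.dvd (by simp [Int.ModEq])
  rw [floquetDet, floquetDet, ← Matrix.det_submatrix_equiv_self e
    (blockD q a z + blockB q V - lam • 1)]
  congr 1
  rw [Matrix.submatrix_sub, Matrix.submatrix_add, Matrix.submatrix_smul]
  simp only [Pi.sub_apply, Pi.add_apply, Pi.smul_apply, Matrix.submatrix_one_equiv]
  congr 2
  · ext ⟨w, i⟩ ⟨w', j⟩
    simp only [blockD, Matrix.of_apply, Matrix.submatrix_apply, e, Equiv.prodCongr_apply,
      Prod.map, Equiv.coe_addRight, Equiv.refl_apply, add_left_inj]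
    rw [twist_congr hq (hadd w) z, twist_add]
  · ext ⟨w, i⟩ ⟨w', j⟩
    simp only [blockB, Matrix.of_apply, Matrix.submatrix_apply, e, Equiv.prodCongr_apply,
      Prod.map, Equiv.coe_addRight, Equiv.refl_apply]
    rw [fourierCoeff_congr hq _ (n := w.toInt - w'.toInt)]
    intro k
    have h1 := hadd w k
    have h2 := hadd w' k
    have h3 := dvd_sub h2 h1
    simp only [Pi.add_apply, Pi.sub_apply] at h3 ⊢
    obtain ⟨l, hl⟩ := h3
    exact ⟨l, by linarith⟩

/-- Exponents of a Laurent polynomial invariant under the dual lattice are multiples of the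
periods. -/
lemma dvd_of_value_twist (hq : ∀ i, 0 < q i) {D : Laurent d}
    (hD : ∀ (c : Cell q) (z : Torus d), D.value (twist q c.toInt z) = D.value z)
    {α : Fin d → ℤ} (hα : α ∈ D.coeff.support) (i : Fin d) : (q i : ℤ) ∣ α i := by
  have : ∀ i, NeZero (q i) := fun i => ⟨(hq i).ne'⟩
  -- Treated apart because `1 = 0` in `Fin 1`, so the unit shift `c` below would be trivial.
  by_cases hqi : q i = 1
  · simp [hqi]
  let c : Cell q := Pi.single i 1
  have hci : c.toInt i = 1 := by
    have : 1 < q i := by have := hq i; omega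
    simp [c, Cell.toInt, Nat.mod_eq_of_lt this]
  have hcj : ∀ j, j ≠ i → c.toInt j = 0 := by
    intro j hj
    simp [c, Cell.toInt, Pi.single_eq_of_ne hj]
  -- `D'` is `D` with its argument twisted by `c`. Comparing coefficients shows that a primitive `q
  -- i`-th root of unity raised to `α i` is 1.
  let D' : Laurent d := ofCoeff (Finsupp.onFinset D.coeff.support
    (fun β => D.coeff β * monomialValue (twist q c.toInt 1) β) fun β hβ =>
      Finsupp.mem_support_iff.2 (left_ne_zero_of_mul hβ))
  have hDD' : D' = D := by
    refine laurent_ext_value fun z => ?_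
    rw [← hD c z, Laurent.value, Laurent.value]
    rw [Finsupp.onFinset_sum]
    · refine Finset.sum_congr rfl fun β _ => ?_
      beta_reduce
      rw [twist_eq_mul c.toInt z, monomialValue_mul]
      ring
    · simp
  have h1 : D.coeff α * monomialValue (twist q c.toInt 1) α = D.coeff α * 1 := by
    have : D'.coeff α = D.coeff α := by rw [hDD']
    rw [mul_one]
    exact this
  have h2 := mul_left_cancel₀ (Finsupp.mem_support_iff.1 hα) h1
  rw [monomialValue, Finset.prod_eq_single i] at h2
  · have hprim := Complex.isPrimitiveRoot_exp (q i) (hq i).ne'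
    refine (hprim.zpow_eq_one_iff_dvd (α i)).1 ?_
    rw [← h2]
    simp [twist, hci, div_eq_mul_inv]
  · intro j _ hj
    simp [twist, hcj j hj]
  · simp

/-- A Laurent polynomial with exponents in `q ⊙ ℤ^d` is a Laurent polynomial in `z^{⊙ q}`. -/
lemma exists_value_multipliers (hq : ∀ i, 0 < q i) {D : Laurent d}
    (hD : ∀ α ∈ D.coeff.support, ∀ i, (q i : ℤ) ∣ α i) :
    ∃ P : Laurent d, (∀ z, D.value z = P.value (multipliers q z)) ∧
      ∀ α, P.coeff α = D.coeff fun i => q i * α i := by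
  let m : (Fin d → ℤ) → (Fin d → ℤ) := fun α i => q i * α i
  have hm : Function.Injective m := by
    intro α β h
    funext i
    have := congrFun h i
    exact mul_left_cancel₀ (by exact_mod_cast (hq i).ne') this
  have hrange : (D.coeff.support : Set (Fin d → ℤ)) ⊆ Set.range m := by
    intro α hα
    choose k hk using hD α hα
    exact ⟨k, funext fun i => (hk i).symm⟩
  refine ⟨comapDomain m hm D, fun z => ?_, fun α => rfl⟩
  conv_lhs => rw [← mapDomain_comapDomain hrange hm]
  rw [Laurent.value, coeff_mapDomain, Finsupp.sum_mapDomain_index (by simp)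
    (fun _ _ _ => add_mul _ _ _), Laurent.value]
  refine Finsupp.sum_congr fun α _ => ?_
  congr 1
  simp only [monomialValue, multipliers, m]
  refine Finset.prod_congr rfl fun i _ => ?_
  rw [zpow_mul, zpow_natCast]

/-- Needed so that every zero of the Fermi polynomial comes from some `z`. -/
lemma multipliers_surjective (hq : ∀ i, 0 < q i) : Function.Surjective (multipliers q) := by
  intro x
  have : ∀ i, ∃ y : ℂˣ, y ^ q i = x i := by
    intro i
    obtain ⟨y, hy⟩ := IsAlgClosed.exists_pow_nat_eq (x i : ℂ) (hq i)
    have hy0 : y ≠ 0 := by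
      rintro rfl
      rw [zero_pow (hq i).ne'] at hy
      exact (x i).ne_zero hy.symm
    exact ⟨Units.mk0 y hy0, by ext; simpa using hy⟩
  choose y hy using this
  exact ⟨y, funext hy⟩

lemma fermiVariety_eq {ν : ℕ} (hq : ∀ i, 0 < q i) {a : Fin ν → Fin ν → (Fin d → ℤ) → ℂ}
    {V : (Fin d → ℤ) → Fin ν → ℂ} {lam : ℂ} {P : Laurent d}
    (hP : IsFermiPolynomial q a V lam P) :
    fermiVariety q a V lam = {x | P.value x = 0} := by
  ext x
  constructor
  · rintro ⟨z, hz, rfl⟩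
    exact (hP z).symm.trans hz
  · intro hx
    obtain ⟨z, rfl⟩ := multipliers_surjective hq x
    exact ⟨z, (hP z).trans hx, rfl⟩

end Twist

/-! ### Determinants of nearest-neighbour matrices on the square lattice. -/

section Cross

/-- The matrix `T₀ + z₁ T₁ + z₁⁻¹ S₁ + z₂ T₂ + z₂⁻¹ S₂`. -/
def crossMatrix {n : Type*} (T₀ T₁ S₁ T₂ S₂ : Matrix n n ℂ) : Matrix n n (Laurent 2) :=
  Matrix.of fun i j => single 0 (T₀ i j) + single ![1, 0] (T₁ i j) + single ![-1, 0] (S₁ i j)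
    + single ![0, 1] (T₂ i j) + single ![0, -1] (S₂ i j)

lemma mem_support_crossMatrix {n : Type*} {T₀ T₁ S₁ T₂ S₂ : Matrix n n ℂ} {i j : n} {α : Fin 2 → ℤ}
    (h : α ∈ (crossMatrix T₀ T₁ S₁ T₂ S₂ i j).coeff.support) :
    α = 0 ∨ α = ![1, 0] ∨ α = ![-1, 0] ∨ α = ![0, 1] ∨ α = ![0, -1] := by
  by_contra! hne
  obtain ⟨h0, h1, h2, h3, h4⟩ := hne
  rw [Finsupp.mem_support_iff] at h
  apply h
  simp [crossMatrix, h0.symm, h1.symm, h2.symm, h3.symm, h4.symm]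

variable {n : Type*} [Fintype n] [DecidableEq n]

lemma le_of_mem_support_det_crossMatrix {T₀ T₁ S₁ T₂ S₂ : Matrix n n ℂ} (φ : (Fin 2 → ℤ) →+ ℤ)
    (hφ : |φ ![1, 0]| ≤ 1 ∧ |φ ![0, 1]| ≤ 1) {α : Fin 2 → ℤ}
    (h : α ∈ (crossMatrix T₀ T₁ S₁ T₂ S₂).det.coeff.support) : |φ α| ≤ Fintype.card n := by
  have e1 : (![-1, 0] : Fin 2 → ℤ) = -![1, 0] := by simp
  have e2 : (![0, -1] : Fin 2 → ℤ) = -![0, 1] := by simp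
  have key : ∀ i j, ∀ β ∈ (crossMatrix T₀ T₁ S₁ T₂ S₂ i j).coeff.support, |φ β| ≤ 1 := by
    intro i j β hβ
    rcases mem_support_crossMatrix hβ with rfl | rfl | rfl | rfl | rfl
    · simp
    · exact hφ.1
    · rw [e1, map_neg, abs_neg]; exact hφ.1
    · exact hφ.2
    · rw [e2, map_neg, abs_neg]; exact hφ.2
  rw [abs_le']
  constructor
  · exact le_of_mem_support_det φ _ (fun i j β hβ => (abs_le'.1 (key i j β hβ)).1) α h
  · exact le_of_mem_support_det (-φ) _ (fun i j β hβ => (abs_le'.1 (key i j β hβ)).2) α h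

/-- Among the five exponents of the entries, each of the four unit vectors is the only maximizer of
a signed coordinate, so `coeff_det_top` applies. -/
lemma coeff_det_crossMatrix (T₀ T₁ S₁ T₂ S₂ : Matrix n n ℂ) :
    (crossMatrix T₀ T₁ S₁ T₂ S₂).det.coeff ![Fintype.card n, 0] = T₁.det ∧
    (crossMatrix T₀ T₁ S₁ T₂ S₂).det.coeff ![-Fintype.card n, 0] = S₁.det ∧
    (crossMatrix T₀ T₁ S₁ T₂ S₂).det.coeff ![0, Fintype.card n] = T₂.det ∧
    (crossMatrix T₀ T₁ S₁ T₂ S₂).det.coeff ![0, -Fintype.card n] = S₂.det := by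
  let x : Fin 2 → (Fin 2 → ℤ) →+ ℤ := fun k => Pi.evalAddMonoidHom (fun _ => ℤ) k
  have key : ∀ (φ : (Fin 2 → ℤ) →+ ℤ) (v : Fin 2 → ℤ) (T : Matrix n n ℂ), φ v = 1 →
      (∀ α : Fin 2 → ℤ, α = 0 ∨ α = ![1, 0] ∨ α = ![-1, 0] ∨ α = ![0, 1] ∨ α = ![0, -1] →
        φ α ≤ 1 ∧ (φ α = 1 → α = v)) →
      (∀ i j, (crossMatrix T₀ T₁ S₁ T₂ S₂ i j).coeff v = T i j) →
      (crossMatrix T₀ T₁ S₁ T₂ S₂).det.coeff (Fintype.card n • v) = T.det := by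
    intro φ v T hv h hT
    rw [coeff_det_top φ v hv _ fun i j α hα => h α (mem_support_crossMatrix hα)]
    congr 1
    ext i j
    exact hT i j
  refine ⟨?_, ?_, ?_, ?_⟩
  · convert key (x 0) ![1, 0] T₁ ?_ ?_ ?_ using 2
    · simp
    · simp [x]
    · rintro α (rfl | rfl | rfl | rfl | rfl) <;> simp [x]
    · simp [crossMatrix]
  · convert key (-x 0) ![-1, 0] S₁ ?_ ?_ ?_ using 2
    · simp
    · simp [x]
    · rintro α (rfl | rfl | rfl | rfl | rfl) <;> simp [x]
    · simp [crossMatrix]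
  · convert key (x 1) ![0, 1] T₂ ?_ ?_ ?_ using 2
    · simp
    · simp [x]
    · rintro α (rfl | rfl | rfl | rfl | rfl) <;> simp [x]
    · simp [crossMatrix]
  · convert key (-x 1) ![0, -1] S₂ ?_ ?_ ?_ using 2
    · simp
    · simp [x]
    · rintro α (rfl | rfl | rfl | rfl | rfl) <;> simp [x]
    · simp [crossMatrix]

end Cross

/-! ### The Floquet matrix sorted by vertex type. -/

section Lieb

variable (q : Fin 2 → ℕ) (V : (Fin 2 → ℤ) → Fin 3 → ℂ)

/-- The Floquet matrix `D_z + B_V` of the Lieb lattice as a matrix of Laurent polynomials. -/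
def liebMatrix : Matrix (Cell q × Fin 3) (Cell q × Fin 3) (Laurent 2) :=
  Matrix.of fun r s => (if r.1 = s.1 then liebLaurent (twist q r.1.toInt 1) r.2 s.2 else 0)
    + single 0 (blockB q V r s)

lemma value_det_liebMatrix (lam : ℂ) (z : Torus 2) :
    (liebMatrix q V - Matrix.scalar _ (single 0 lam)).det.value z
      = floquetDet q liebCoeff V lam z := by
  rw [← valueHom_apply, AlgHom.map_det, floquetDet]
  congr 1
  ext r s
  have h1 : valueHom z (if r.1 = s.1 then liebLaurent (twist q r.1.toInt 1) r.2 s.2 else 0)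
      = if r.1 = s.1 then symbol liebCoeff (twist q r.1.toInt z) r.2 s.2 else 0 := by
    rw [twist_eq_mul _ z, ← valueHom_liebLaurent]
    split_ifs <;> simp
  have h2 : valueHom z (if r = s then single 0 lam else 0) = if r = s then lam else 0 := by
    split_ifs <;> simp [monomialValue_zero]
  simp only [AlgHom.mapMatrix_apply, Matrix.map_apply, Matrix.sub_apply, liebMatrix,
    Matrix.of_apply, Matrix.scalar_apply, Matrix.diagonal_apply, map_sub, map_add, h1, h2,
    Matrix.add_apply, Matrix.smul_apply, Matrix.one_apply, valueHom_single, monomialValue_zero,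
    mul_one, blockD, smul_eq_mul, mul_ite, mul_zero]

/-- The block of `B_V` for the vertices of type `j`. -/
def typeBlock (j : Fin 3) : Matrix (Cell q) (Cell q) ℂ :=
  (blockB q V).submatrix (fun w => (w, j)) fun w => (w, j)

/-- Sorting the indices by the type of the vertex. -/
def typeEquiv : Cell q ⊕ (Cell q ⊕ Cell q) ≃ Cell q × Fin 3 where
  toFun := Sum.elim (fun w => (w, 0)) (Sum.elim (fun w => (w, 1)) fun w => (w, 2))
  invFun r := ![Sum.inl r.1, Sum.inr (Sum.inl r.1), Sum.inr (Sum.inr r.1)] r.2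
  left_inv := by rintro (w | w | w) <;> rfl
  right_inv := by rintro ⟨w, j⟩; fin_cases j <;> rfl

/-- `1 + ω_w z_k`, with `e` the exponent of `z_k`. -/
def hop (k : Fin 2) (e : Fin 2 → ℤ) (w : Cell q) : Laurent 2 :=
  1 + single e (twist q w.toInt 1 k : ℂ)

/-- `1 + (ω_w z_k)⁻¹`, with `e` the exponent of `z_k⁻¹`. -/
def hopInv (k : Fin 2) (e : Fin 2 → ℤ) (w : Cell q) : Laurent 2 :=
  1 + single e (twist q w.toInt 1 k : ℂ)⁻¹

/-- Types 1 and 2 are not adjacent to each other or to themselves, so their block is block diagonal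
and independent of `z`: it can be inverted over `ℂ`. -/
lemma submatrix_liebMatrix (lam : ℂ) :
    (liebMatrix q V - Matrix.scalar _ (single 0 lam)).submatrix (typeEquiv q) (typeEquiv q) =
      Matrix.fromBlocks
        (singleZeroRingHom.mapMatrix (typeBlock q V 0 - Matrix.scalar _ lam))
        (Matrix.fromCols (Matrix.diagonal (hopInv q 0 ![-1, 0]))
          (Matrix.diagonal (hopInv q 1 ![0, -1])))
        (Matrix.fromRows (Matrix.diagonal (hop q 0 ![1, 0])) (Matrix.diagonal (hop q 1 ![0, 1])))
        (Matrix.fromBlocks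
          (singleZeroRingHom.mapMatrix (typeBlock q V 1 - Matrix.scalar _ lam)) 0 0
          (singleZeroRingHom.mapMatrix (typeBlock q V 2 - Matrix.scalar _ lam))) := by
  have hsc : ∀ w w' : Cell q, (single 0 (if w = w' then lam else 0) : Laurent 2)
      = if w = w' then single 0 lam else 0 := by
    intro w w'
    split_ifs <;> simp
  have hsub : ∀ a b : ℂ, (single 0 (a - b) : Laurent 2) = single 0 a - single 0 b :=
    fun a b => map_sub (singleZeroRingHom (R := ℂ) (M := Fin 2 → ℤ)) a b
  ext r s : 2
  rcases r with w | w | w <;> rcases s with w' | w' | w' <;>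
    simp [liebMatrix, typeEquiv, typeBlock, liebLaurent, hop, hopInv, Matrix.diagonal_apply,
      hsub, hsc, singleZeroRingHom_apply, blockB]

end Lieb

/-! ### Schur complement and irreducibility of the Fermi polynomial. -/

section Lieb

variable (q : Fin 2 → ℕ) (V : (Fin 2 → ℤ) → Fin 3 → ℂ)

/-- Eliminating the vertices of degree two leaves a weighted square lattice. -/
lemma exists_det_liebMatrix_eq {lam : ℂ}
    (h1 : (typeBlock q V 1 - Matrix.scalar _ lam).det ≠ 0)
    (h2 : (typeBlock q V 2 - Matrix.scalar _ lam).det ≠ 0) :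
    ∃ (c : ℂ) (T₀ T₁ S₁ T₂ S₂ : Matrix (Cell q) (Cell q) ℂ), c ≠ 0 ∧
      T₁.det ≠ 0 ∧ S₁.det ≠ 0 ∧ T₂.det ≠ 0 ∧ S₂.det ≠ 0 ∧
      (liebMatrix q V - Matrix.scalar _ (single 0 lam)).det =
        single 0 c * (crossMatrix T₀ T₁ S₁ T₂ S₂).det := by
  set ι : Matrix (Cell q) (Cell q) ℂ →+* Matrix (Cell q) (Cell q) (Laurent 2) :=
    singleZeroRingHom.mapMatrix
  have hι : ∀ M w w', ι M w w' = single 0 (M w w') := fun _ _ _ => rfl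
  set B₁ := typeBlock q V 1 - Matrix.scalar _ lam
  set B₂ := typeBlock q V 2 - Matrix.scalar _ lam
  have hu₁ : IsUnit B₁.det := isUnit_iff_ne_zero.2 h1
  have hu₂ : IsUnit B₂.det := isUnit_iff_ne_zero.2 h2
  let inv : Invertible (Matrix.fromBlocks (ι B₁) 0 0 (ι B₂)) :=
    { invOf := Matrix.fromBlocks (ι B₁⁻¹) 0 0 (ι B₂⁻¹)
      invOf_mul_self := by
        simp [Matrix.fromBlocks_multiply, ← map_mul, Matrix.nonsing_inv_mul _ hu₁,
          Matrix.nonsing_inv_mul _ hu₂]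
      mul_invOf_self := by
        simp [Matrix.fromBlocks_multiply, ← map_mul, Matrix.mul_nonsing_inv _ hu₁,
          Matrix.mul_nonsing_inv _ hu₂] }
  have hinv : ⅟(Matrix.fromBlocks (ι B₁) 0 0 (ι B₂)) =
      Matrix.fromBlocks (ι B₁⁻¹) 0 0 (ι B₂⁻¹) := rfl
  let Ω : Fin 2 → Matrix (Cell q) (Cell q) ℂ := fun k =>
    Matrix.diagonal fun w => (twist q w.toInt 1 k : ℂ)
  let Ω' : Fin 2 → Matrix (Cell q) (Cell q) ℂ := fun k =>
    Matrix.diagonal fun w => (twist q w.toInt 1 k : ℂ)⁻¹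
  have hΩ : ∀ k, (Ω k).det ≠ 0 := fun k => by
    simp only [Ω, Matrix.det_diagonal]
    exact Finset.prod_ne_zero_iff.2 fun w _ => Units.ne_zero _
  have hΩ' : ∀ k, (Ω' k).det ≠ 0 := fun k => by
    simp only [Ω', Matrix.det_diagonal]
    exact Finset.prod_ne_zero_iff.2 fun w _ => inv_ne_zero (Units.ne_zero _)
  have hi₁ : (-B₁⁻¹).det ≠ 0 := by
    rw [Matrix.det_neg, Matrix.det_nonsing_inv, Ring.inverse_eq_inv']
    exact mul_ne_zero (pow_ne_zero _ (by norm_num)) (inv_ne_zero h1)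
  have hi₂ : (-B₂⁻¹).det ≠ 0 := by
    rw [Matrix.det_neg, Matrix.det_nonsing_inv, Ring.inverse_eq_inv']
    exact mul_ne_zero (pow_ne_zero _ (by norm_num)) (inv_ne_zero h2)
  -- The Schur complement subtracts `(1 + z_k⁻¹ Ω') B⁻¹ (1 + z_k Ω)` for each of the two types.
  -- Expanding it, the constant terms go to `T₀` and the terms in `z_k^{±1}` give the invertible
  -- hopping matrices.
  refine ⟨B₁.det * B₂.det,
    (typeBlock q V 0 - Matrix.scalar _ lam) - (B₁⁻¹ + Ω' 0 * B₁⁻¹ * Ω 0)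
      - (B₂⁻¹ + Ω' 1 * B₂⁻¹ * Ω 1),
    -B₁⁻¹ * Ω 0, Ω' 0 * -B₁⁻¹, -B₂⁻¹ * Ω 1, Ω' 1 * -B₂⁻¹, mul_ne_zero h1 h2, ?_, ?_, ?_, ?_, ?_⟩
  · rw [Matrix.det_mul]; exact mul_ne_zero hi₁ (hΩ 0)
  · rw [Matrix.det_mul]; exact mul_ne_zero (hΩ' 0) hi₁
  · rw [Matrix.det_mul]; exact mul_ne_zero hi₂ (hΩ 1)
  · rw [Matrix.det_mul]; exact mul_ne_zero (hΩ' 1) hi₂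
  · rw [← Matrix.det_submatrix_equiv_self (typeEquiv q), submatrix_liebMatrix,
      Matrix.det_fromBlocks₂₂]
    rw [hinv]
    congr 1
    · rw [Matrix.det_fromBlocks_zero₂₁]
      simp only [← RingHom.map_det, ← map_mul]
      rfl
    · congr 1
      change ι (typeBlock q V 0 - Matrix.scalar _ lam) - _ = _
      rw [Matrix.fromCols_mul_fromBlocks, Matrix.fromCols_mul_fromRows]
      refine Matrix.ext fun w w' => ?_
      simp only [Matrix.mul_zero, add_zero, zero_add, Matrix.sub_apply, Matrix.add_apply,
        Matrix.diagonal_mul, Matrix.mul_diagonal, Matrix.neg_apply, crossMatrix, Matrix.of_apply,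
        Ω, Ω', hι, hop, hopInv,
        mul_add, add_mul, one_mul, mul_one, single_mul_single, single_add, single_sub]
      have e0 : (![-1, 0] + ![1, 0] : Fin 2 → ℤ) = 0 := by simp
      have e1 : (![0, -1] + ![0, 1] : Fin 2 → ℤ) = 0 := by simp
      simp only [e0, e1, mul_neg, neg_mul, single_neg]
      ring

variable {q}

/-- Outside the zeros of three polynomials in `lam` the Fermi polynomial is irreducible: its Newton
polygon is a parallelogram with primitive edges and an interior exponent. -/
lemma exists_isFermiPolynomial_irreducible (hq : ∀ i, 0 < q i)
    (hcop : Nat.gcd (q 0) (q 1) = 1) {lam : ℂ}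
    (h0 : (liebMatrix q V - Matrix.scalar _ (single 0 lam)).det.coeff 0 ≠ 0)
    (h1 : (typeBlock q V 1 - Matrix.scalar _ lam).det ≠ 0)
    (h2 : (typeBlock q V 2 - Matrix.scalar _ lam).det ≠ 0) :
    ∃ P : Laurent 2, IsFermiPolynomial q liebCoeff V lam P ∧ Irreducible P := by
  set D := (liebMatrix q V - Matrix.scalar _ (single 0 lam)).det with hD
  have hval : ∀ z, D.value z = floquetDet q liebCoeff V lam z := value_det_liebMatrix q V lam
  obtain ⟨P, hP, hPD⟩ := exists_value_multipliers hq (D := D) fun α hα i =>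
    dvd_of_value_twist hq (fun c z => by rw [hval, hval, floquetDet_twist hq]) hα i
  refine ⟨P, fun z => (hval z).symm.trans (hP z), ?_⟩
  obtain ⟨c, T₀, T₁, S₁, T₂, S₂, hc, hT₁, hS₁, hT₂, hS₂, hdet⟩ := exists_det_liebMatrix_eq q V h1 h2
  rw [← hD] at hdet
  have hcoeff : ∀ α, D.coeff α = c * (crossMatrix T₀ T₁ S₁ T₂ S₂).det.coeff α := fun α => by
    rw [hdet, coeff_single_zero_mul]
  have hcard : Fintype.card (Cell q) = q 0 * q 1 := by
    simp [Fintype.card_pi, Fin.prod_univ_two]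
  obtain ⟨v₁, v₂, v₃, v₄⟩ := coeff_det_crossMatrix T₀ T₁ S₁ T₂ S₂
  have hbound : ∀ φ : (Fin 2 → ℤ) →+ ℤ, |φ ![1, 0]| ≤ 1 ∧ |φ ![0, 1]| ≤ 1 →
      ∀ α ∈ P.coeff.support, |φ fun i => q i * α i| ≤ (q 0 * q 1 : ℤ) := by
    intro φ hφ α hα
    have := le_of_mem_support_det_crossMatrix (T₀ := T₀) (T₁ := T₁) (S₁ := S₁) (T₂ := T₂) (S₂ := S₂)
      φ hφ (α := fun i => q i * α i) (by
        rw [Finsupp.mem_support_iff, hPD, hcoeff] at hα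
        exact Finsupp.mem_support_iff.2 (right_ne_zero_of_mul hα))
    rw [hcard] at this
    exact_mod_cast this
  let x : Fin 2 → (Fin 2 → ℤ) →+ ℤ := fun k => Pi.evalAddMonoidHom (fun _ => ℤ) k
  have hq0 : (0 : ℤ) < q 0 := by exact_mod_cast hq 0
  have hq1 : (0 : ℤ) < q 1 := by exact_mod_cast hq 1
  -- `s` and `d` are `x 0 ± x 1` on the exponents of `D`; they turn the diamond into a square.
  let s : (Fin 2 → ℤ) →+ ℤ := (q 0 : ℤ) • x 0 + (q 1 : ℤ) • x 1
  let d : (Fin 2 → ℤ) →+ ℤ := (q 0 : ℤ) • x 0 - (q 1 : ℤ) • x 1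
  have hs : ∀ α, s α = q 0 * α 0 + q 1 * α 1 := fun α => by simp [s, x]
  have hd : ∀ α, d α = q 0 * α 0 - q 1 * α 1 := fun α => by simp [d, x]
  have hcop' : IsCoprime (q 1 : ℤ) (q 0 : ℤ) := (Nat.isCoprime_iff_coprime.2 hcop).symm
  have hdvd : ∀ α : Fin 2 → ℤ, (q 1 : ℤ) ∣ q 0 * α 0 → ∃ t, α 0 = q 1 * t := fun α h =>
    hcop'.dvd_of_dvd_mul_left h
  have hvertex : ∀ (a b m n : ℤ), a = q 0 * m + q 1 * n → b = q 0 * m - q 1 * n →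
      D.coeff ![q 0 * m, q 1 * n] ≠ 0 → ∃ α ∈ P.coeff.support, s α = a ∧ d α = b := by
    rintro _ _ m n rfl rfl h
    refine ⟨![m, n], ?_, by simp [hs], by simp [hd]⟩
    rw [Finsupp.mem_support_iff, hPD]
    convert h using 2
    funext i
    fin_cases i <;> rfl
  refine IsPrimitiveParallelogram.irreducible (s := s) (d := d) (Q := q 0 * q 1)
    ⟨?_, by positivity, ?_, ?_, ?_, ?_⟩ ?_
  · intro α h h'
    rw [hs] at h
    rw [hd] at h'
    funext i
    fin_cases i
    · exact (mul_eq_zero.1 (by linarith : (q 0 : ℤ) * α 0 = 0)).resolve_left hq0.ne'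
    · exact (mul_eq_zero.1 (by linarith : (q 1 : ℤ) * α 1 = 0)).resolve_left hq1.ne'
  · intro α h
    rw [hs] at h
    -- Coprimality gives primitivity: `α 0 = q 1 * t`, hence `d α = 2 * q 0 * α 0 = 2Q t`.
    obtain ⟨t, ht⟩ := hdvd α ⟨-α 1, by linarith⟩
    exact ⟨t, by rw [hd]; linear_combination 2 * (q 0 : ℤ) * ht - h⟩
  · intro α h
    rw [hd] at h
    obtain ⟨t, ht⟩ := hdvd α ⟨α 1, by linarith⟩
    exact ⟨t, by rw [hs]; linear_combination 2 * (q 0 : ℤ) * ht - h⟩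
  · intro α hα
    rw [hs, hd]
    exact ⟨hbound (x 0 + x 1) (by simp [x]) α hα, hbound (x 0 - x 1) (by simp [x]) α hα⟩
  · intro a b ha hb
    rw [abs_eq (by positivity)] at ha hb
    rw [hcard] at v₁ v₂ v₃ v₄
    push_cast at v₁ v₂ v₃ v₄
    -- The corners come from the exponents `(q 1, 0)`, `(0, q 0)`, `(0, -q 0)`, `(-q 1, 0)` of `P`,
    -- in this order.
    rcases ha with rfl | rfl <;> rcases hb with rfl | rfl
    · refine hvertex _ _ (q 1) 0 (by ring) (by ring) ?_
      rw [mul_zero, hcoeff, v₁]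
      exact mul_ne_zero hc hT₁
    · refine hvertex _ _ 0 (q 0) (by ring) (by ring) ?_
      rw [mul_zero, mul_comm (q 1 : ℤ), hcoeff, v₃]
      exact mul_ne_zero hc hT₂
    · refine hvertex _ _ 0 (-q 0) (by ring) (by ring) ?_
      rw [mul_zero, mul_neg, mul_comm (q 1 : ℤ), hcoeff, v₄]
      exact mul_ne_zero hc hS₂
    · refine hvertex _ _ (-q 1) 0 (by ring) (by ring) ?_
      rw [mul_zero, mul_neg, hcoeff, v₂]
      exact mul_ne_zero hc hS₁
  · rw [hPD]
    simpa [← Pi.zero_def] using h0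

end Lieb

end PeriodicGraph
end

/-! ### The main theorem. -/

open PeriodicGraph in
theorem mainTheorem3 (q : Fin 2 → ℕ) (hq : ∀ i, 0 < q i) (hcop : Nat.gcd (q 0) (q 1) = 1)
    (V : (Fin 2 → ℤ) → Fin 3 → ℂ) (hV : PeriodicGraph.IsPeriodic q V) :
    ∃ Z : Set ℂ, Z.Finite ∧ ∀ lam : ℂ, lam ∉ Z →
      (∃ P : PeriodicGraph.Laurent 2,
        PeriodicGraph.IsFermiPolynomial q PeriodicGraph.liebCoeff V lam P ∧ Irreducible P) ∧
      PeriodicGraph.IsIrreducibleVariety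
        (PeriodicGraph.fermiVariety q PeriodicGraph.liebCoeff V lam) := by
  -- Exceptional energies: those killing the interior exponent 0, and the eigenvalues of the two
  -- eliminated blocks.
  refine ⟨_, ((finite_coeff_zero_det_eq_zero (liebMatrix q V)).union
    (finite_det_sub_eq_zero (typeBlock q V 1))).union
    (finite_det_sub_eq_zero (typeBlock q V 2)), fun lam hlam => ?_⟩
  simp only [Set.mem_union, not_or] at hlam
  obtain ⟨P, hP, hirr⟩ :=
    exists_isFermiPolynomial_irreducible V hq hcop hlam.1.1 hlam.1.2 hlam.2
  refine ⟨⟨P, hP, hirr⟩, ?_⟩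
  rw [fermiVariety_eq hq hP]
  exact isIrreducibleVariety_of_irreducible hirr
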